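/- Let $n\ge 1$, let $k$ be a commutative Artinian ring, and let $\Lambda,\Lambda'$ be Artin $k$-algebras, i.e. $k$-algebras that are finitely generated as $k$-modules. Write $\mathrm{mod}\text{-}\Lambda$ for the category of finitely generated right $\Lambda$-modules. **Definitions.** - A full subcategory $\mathscr M$ of an abelian category $\mathscr A$ is *$n$-cluster tilting* if it is closed under isomorphisms, finite direct sums and direct summands, is functorially finite (every object of $\mathscr A$ has an $\mathscr M$-precover and an $\mathscr M$-preenvelope), is generating and cogenerating (every object of $\mathscr A$ is a quotient of, and a subobject of, an object of $\mathscr M$), and $$\{a : \mathrm{Ext}^i_{\mathscr A}(\mathscr M,a)=0,\ 0<i<n\}=\mathscr M=\{a : \mathrm{Ext}^i_{\mathscr A}(a,\mathscr M)=0,\ 0<i<n\}.$$ If $\mathscr A=\mathrm{mod}\text{-}\Lambda$, then $(\Lambda,\mathscr M)$ is called an *$n$-homological pair*. - For $n$-homological pairs $(\Lambda,\mathscr M)$ and $(\Lambda',\mathscr M')$, an *epimorphism of $n$-homological pairs* $(\Lambda,\mathscr M)\to(\Lambda',\mathscr M')$ is a $k$-algebra homomorphism $\phi:\Lambda\to\Lambda'$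 which is an epimorphism in the category of rings and satisfies $\phi_*(\mathscr M')\subseteq\mathscr M$. Here $\phi_*:\mathrm{mod}\text{-}\Lambda'\to\mathrm{mod}\text{-}\Lambda$ is restriction of scalars, and the image under $\phi_*$ of a full subcategory always means its essential image. - Let $\mathscr C$ be an additive category and let $m_{n+1}\xrightarrow{u_{n+1}} m_n\to\cdots\to m_1\xrightarrow{u_1} m_0$ be a sequence in $\mathscr C$. The maps $(u_n,\dots,u_1)$ form an *$n$-cokernel* of $u_{n+1}$ if $0\to\mathscr C(m_0,m)\to\cdots\to\mathscr C(m_n,m)\to\mathscr C(m_{n+1},m)$ is exact for all $m\in\mathscr C$; dually, $(u_{n+1},\dots,u_2)$ form an *$n$-kernel* of $u_1$ if $0\to\mathscr C(m,m_{n+1})\to\cdots\to\mathscr C(m,m_1)\to\mathscr C(m,m_0)$ is exact for all $m\in\mathscr C$. The sequence is *$n$-exact* if both hold. The category $\mathscr C$ is *$n$-abelian* if it is idempotent complete, every morphism has an $n$-kernel and an $n$-cokernel, and every monomorphism (resp. epimorphism) can be completed to an $n$-exact sequence as its first map (resp. last map). - Let $\mathscr X\subseteq\mathscr M$ be full subcategories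 of an abelian category $\mathscr A$. Let $\mathscr X\text{-}\mathrm{exact}_n$ be the class of sequences $m_n\to\cdots\to m_1$ in $\mathscr M$ such that $0\to\mathrm{Ext}^n_{\mathscr A}(x,m_n)\to\cdots\to\mathrm{Ext}^n_{\mathscr A}(x,m_1)\to0$ is exact for all $x\in\mathscr X$. Let ${}^{\perp}(\mathscr X\text{-}\mathrm{exact}_n)$ be the full subcategory of all $m\in\mathscr M$ such that $0\to\mathrm{Ext}^n_{\mathscr A}(m,m_n)\to\cdots\to\mathrm{Ext}^n_{\mathscr A}(m,m_1)\to0$ is exact for every sequence in $\mathscr X\text{-}\mathrm{exact}_n$. Then $\mathscr X$ is an *$n$-cotorsion class* in $\mathscr M$ if $\mathscr X={}^{\perp}(\mathscr X\text{-}\mathrm{exact}_n)$. **Proposition.** Let $\phi:(\Lambda,\mathscr M)\to(\Lambda',\mathscr M')$ be an epimorphism of $n$-homological pairs. Assume that (i) for all $m',m''\in\mathscr M'$, the map $\mathrm{Ext}^n_{\Lambda'}(m',m'')\to\mathrm{Ext}^n_\Lambda(\phi_*(m'),\phi_*(m''))$ induced by the exact functor $\phi_*$ is bijective; (ii) $\mathscr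 X'$ is an $n$-cotorsion class in $\mathscr M'$ (with $\mathscr A=\mathrm{mod}\text{-}\Lambda'$). Then $\phi_*(\mathscr M')$ is an $n$-abelian category, and $\phi_*(\mathscr X')$ is an $n$-cotorsion class in $\phi_*(\mathscr M')$ (with $\mathscr A=\mathrm{mod}\text{-}\Lambda$). -/

import Mathlib

open CategoryTheory CategoryTheory.Limits

universe w v u

noncomputable section

namespace HigherHomological

/-! ### `n`-exact sequences and `n`-abelian categories

A sequence `m_{n+1} ⟶ m_n ⟶ ⋯ ⟶ m_0` is an object `S : ComposableArrows C (n + 1)`,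
with `S.obj' i` playing the role of `m_{n+1-i}`. -/

section NAbelian

variable {C : Type u} [Category.{v} C] [Preadditive C]

/-- The last `n` maps of `S : m_{n+1} ⟶ ⋯ ⟶ m_0` form an `n`-cokernel of the first one: for every
object `m`, the sequence `0 ⟶ Hom(m_0, m) ⟶ ⋯ ⟶ Hom(m_n, m) ⟶ Hom(m_{n+1}, m)` is exact. -/
structure IsNCokernelSeq {n : ℕ} (S : ComposableArrows C (n + 1)) : Prop where
  injective (m : C) :
    Function.Injective (fun g : S.obj' (n + 1) ⟶ m => S.map' n (n + 1) ≫ g)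
  exact (m : C) (i : ℕ) (hi : i + 2 ≤ n + 1) :
    Function.Exact (fun g : S.obj' (i + 2) ⟶ m => S.map' (i + 1) (i + 2) ≫ g)
      (fun f : S.obj' (i + 1) ⟶ m => S.map' i (i + 1) ≫ f)

/-- The first `n` maps of `S : m_{n+1} ⟶ ⋯ ⟶ m_0` form an `n`-kernel of the last one: for every
object `m`, the sequence `0 ⟶ Hom(m, m_{n+1}) ⟶ ⋯ ⟶ Hom(m, m_1) ⟶ Hom(m, m_0)` is exact. -/
structure IsNKernelSeq {n : ℕ} (S : ComposableArrows C (n + 1)) : Prop where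
  injective (m : C) :
    Function.Injective (fun g : m ⟶ S.obj' 0 => g ≫ S.map' 0 1)
  exact (m : C) (i : ℕ) (hi : i + 2 ≤ n + 1) :
    Function.Exact (fun g : m ⟶ S.obj' i => g ≫ S.map' i (i + 1))
      (fun f : m ⟶ S.obj' (i + 1) => f ≫ S.map' (i + 1) (i + 2))

/-- `n`-exact sequences `0 ⟶ m_{n+1} ⟶ m_n ⟶ ⋯ ⟶ m_1 ⟶ m_0 ⟶ 0`. -/
structure IsNExact {n : ℕ} (S : ComposableArrows C (n + 1)) : Prop where
  isNKernelSeq : IsNKernelSeq S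
  isNCokernelSeq : IsNCokernelSeq S

variable (C) in
/-- `n`-abelian categories: additive, idempotent complete, with `n`-kernels and `n`-cokernels, and
such that monomorphisms (resp. epimorphisms) occur as the first (resp. last) map of an `n`-exact
sequence. -/
structure IsNAbelian (n : ℕ) : Prop where
  hasFiniteBiproducts : HasFiniteBiproducts C
  isIdempotentComplete : IsIdempotentComplete C
  exists_nKernel {a b : C} (f : a ⟶ b) : ∃ S : ComposableArrows C (n + 1),
    IsNKernelSeq S ∧ Nonempty (Arrow.mk (S.map' n (n + 1)) ≅ Arrow.mk f)
  exists_nCokernel {a b : C} (f : a ⟶ b) : ∃ S : ComposableArrows C (n + 1),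
    IsNCokernelSeq S ∧ Nonempty (Arrow.mk (S.map' 0 1) ≅ Arrow.mk f)
  exists_nExact_of_mono {a b : C} (f : a ⟶ b) (hf : Mono f) : ∃ S : ComposableArrows C (n + 1),
    IsNExact S ∧ Nonempty (Arrow.mk (S.map' 0 1) ≅ Arrow.mk f)
  exists_nExact_of_epi {a b : C} (f : a ⟶ b) (hf : Epi f) : ∃ S : ComposableArrows C (n + 1),
    IsNExact S ∧ Nonempty (Arrow.mk (S.map' n (n + 1)) ≅ Arrow.mk f)

end NAbelian

/-! ### `n`-cluster tilting subcategories

Full subcategories of `A` are given by properties of objects of `A`. -/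

section ClusterTilting

variable {A : Type u} [Category.{v} A]

/-- Every object has an `M`-precover (right `M`-approximation). -/
def IsPrecovering (M : ObjectProperty A) : Prop :=
  ∀ a : A, ∃ (m : A) (p : m ⟶ a), M m ∧
    ∀ (m' : A) (g : m' ⟶ a), M m' → ∃ h : m' ⟶ m, h ≫ p = g

/-- Every object has an `M`-preenvelope (left `M`-approximation). -/
def IsPreenveloping (M : ObjectProperty A) : Prop :=
  ∀ a : A, ∃ (m : A) (j : a ⟶ m), M m ∧
    ∀ (m' : A) (g : a ⟶ m'), M m' → ∃ h : m ⟶ m', j ≫ h = g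

/-- Every object is a quotient of an object of `M`. -/
def IsGenerating (M : ObjectProperty A) : Prop :=
  ∀ a : A, ∃ (m : A) (p : m ⟶ a), M m ∧ Epi p

/-- Every object is a subobject of an object of `M`. -/
def IsCogenerating (M : ObjectProperty A) : Prop :=
  ∀ a : A, ∃ (m : A) (j : a ⟶ m), M m ∧ Mono j

variable [Abelian A]

/-- Closure under isomorphisms, finite direct sums and direct summands. -/
structure IsAdditiveSubcategory (M : ObjectProperty A) : Prop where
  isClosedUnderIsomorphisms : M.IsClosedUnderIsomorphisms
  containsZero : M.ContainsZero
  biprod (a b : A) : M a → M b → M (a ⊞ b)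
  isStableUnderRetracts : M.IsStableUnderRetracts

variable [HasExt.{w} A]

/-- Objects `a` such that `Ext^i(M, a) = 0` for all `0 < i < n`. -/
def rightPerp (n : ℕ) (M : ObjectProperty A) : ObjectProperty A :=
  fun a => ∀ m : A, M m → ∀ i : ℕ, 0 < i → i < n → Subsingleton (Abelian.Ext.{w} m a i)

/-- Objects `a` such that `Ext^i(a, M) = 0` for all `0 < i < n`. -/
def leftPerp (n : ℕ) (M : ObjectProperty A) : ObjectProperty A :=
  fun a => ∀ m : A, M m → ∀ i : ℕ, 0 < i → i < n → Subsingleton (Abelian.Ext.{w} a m i)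

/-- `n`-cluster tilting subcategories of an abelian category. -/
structure IsNClusterTilting (n : ℕ) (M : ObjectProperty A) : Prop where
  isAdditiveSubcategory : IsAdditiveSubcategory M
  isPrecovering : IsPrecovering M
  isPreenveloping : IsPreenveloping M
  isGenerating : IsGenerating M
  isCogenerating : IsCogenerating M
  rightPerp_eq : rightPerp.{w} n M = M
  leftPerp_eq : leftPerp.{w} n M = M

end ClusterTilting

/-! ### `n`-cotorsion classes -/

/-- Exactness of `0 ⟶ T_0 ⟶ T_1 ⟶ ⋯ ⟶ T_k ⟶ 0`: at each `T_i`, the elements killed by the outgoing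
map (all of them if `i = k`) are those in the image of the incoming map (only `0` if `i = 0`). -/
def IsExactWithZeros {k : ℕ} (T : ComposableArrows AddCommGrpCat.{w} k) : Prop :=
  ∀ (i : Fin (k + 1)) (y : T.obj i),
    (∀ (j : Fin (k + 1)) (h : i.val + 1 = j.val),
        (T.map (homOfLE (Fin.le_def.2 (by lia) : i ≤ j))).hom y = 0) ↔
      (y = 0 ∨ ∃ (j : Fin (k + 1)) (h : j.val + 1 = i.val) (z : T.obj j),
        (T.map (homOfLE (Fin.le_def.2 (by lia) : j ≤ i))).hom z = y)

section Cotorsion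

variable {A : Type u} [Category.{v} A] [Abelian A] [HasExt.{w} A]

/-- For a sequence `m_n ⟶ ⋯ ⟶ m_1` (`n` objects, hence `n - 1` maps), exactness of
`0 ⟶ Ext^n(x, m_n) ⟶ ⋯ ⟶ Ext^n(x, m_1) ⟶ 0`. -/
def ExtExact (n : ℕ) (x : A) (S : ComposableArrows A (n - 1)) : Prop :=
  IsExactWithZeros (k := n - 1) (S ⋙ Abelian.extFunctorObj.{w} x n)

/-- The class `X-exact_n` of sequences in `M`. -/
def XExact (n : ℕ) (M X : ObjectProperty A) (S : ComposableArrows A (n - 1)) : Prop :=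
  (∀ i, M (S.obj i)) ∧ ∀ x : A, X x → ExtExact.{w} n x S

/-- The left orthogonal, inside `M`, of the class `X-exact_n`. -/
def perpXExact (n : ℕ) (M X : ObjectProperty A) : ObjectProperty A :=
  fun m => M m ∧ ∀ S : ComposableArrows A (n - 1), XExact.{w} n M X S → ExtExact.{w} n m S

/-- `X` is an `n`-cotorsion class in the full subcategory `M` of `A`. -/
def IsNCotorsionClass (n : ℕ) (M X : ObjectProperty A) : Prop :=
  X = perpXExact.{w} n M X

end Cotorsion

/-! ### Finitely generated right modules over Artin algebras

Here `k` is a commutative Artinian ring and `Λ` is a `k`-algebra which is finitely generated as a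
`k`-module. -/

section Modules

variable (k : Type w) [CommRing k]

theorem finite_mulOpposite (Λ : Type u) [Ring Λ] [Algebra k Λ] [Module.Finite k Λ] :
    Module.Finite k Λᵐᵒᵖ :=
  Module.Finite.equiv (MulOpposite.opLinearEquiv k)

theorem finite_restrictScalars {Λ Λ' : Type u} [Ring Λ] [Algebra k Λ]
    [Ring Λ'] [Algebra k Λ'] [Module.Finite k Λ'] (φ : Λ →ₐ[k] Λ')
    (N : FGModuleCat.{u} Λ'ᵐᵒᵖ) :
    ModuleCat.isFG Λᵐᵒᵖ
      ((ModuleCat.restrictScalars (RingHom.op (φ : Λ →+* Λ'))).obj N.obj) := by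
  let M := (ModuleCat.restrictScalars (RingHom.op (φ : Λ →+* Λ'))).obj N.obj
  have := finite_mulOpposite k Λ'
  let : Module k N.obj := Module.compHom N.obj (algebraMap k Λ'ᵐᵒᵖ)
  have : IsScalarTower k Λ'ᵐᵒᵖ N.obj := ⟨fun c x y => by
    rw [Algebra.smul_def, mul_smul]; rfl⟩
  have : Module.Finite Λ'ᵐᵒᵖ N.obj := N.property
  have hfin : Module.Finite k N.obj := Module.Finite.trans Λ'ᵐᵒᵖ N.obj
  let : Module k M := inferInstanceAs (Module k N.obj)
  have : IsScalarTower k Λᵐᵒᵖ M := ⟨fun c x y => by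
    have h : RingHom.op (φ : Λ →+* Λ') (c • x) = c • RingHom.op (φ : Λ →+* Λ') x :=
      MulOpposite.unop_injective (by simp)
    change (RingHom.op (φ : Λ →+* Λ') (c • x)) • (y : N.obj) =
      c • ((RingHom.op (φ : Λ →+* Λ') x) • (y : N.obj))
    have key : ∀ (z : Λ'ᵐᵒᵖ) (t : N.obj), (c • z) • t = c • z • t := fun z t => smul_assoc c z t
    rw [h]
    exact key _ y⟩
  have : Module.Finite k M := hfin
  exact Module.Finite.of_restrictScalars_finite k Λᵐᵒᵖ M

theorem restrictScalars_exact {R S : Type u} [Ring R] [Ring S] (f : R →+* S) :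
    PreservesFiniteLimits (ModuleCat.restrictScalars.{u} f) ∧
      PreservesFiniteColimits (ModuleCat.restrictScalars.{u} f) := by
  refine ((Functor.exact_tfae (ModuleCat.restrictScalars.{u} f)).out 1 3).mp ?_
  intro T h
  rw [ShortComplex.ShortExact.moduleCat_exact_iff_function_exact] at h ⊢
  exact h

variable [IsArtinianRing k]

/-- `mod-Λ`: finitely generated right `Λ`-modules, i.e. left modules over `Λᵐᵒᵖ`. -/
@[nolint unusedArguments]
def FGRightMod (Λ : Type u) [Ring Λ] [Algebra k Λ] [Module.Finite k Λ] : Type (u + 1) :=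
  FGModuleCat.{u} Λᵐᵒᵖ

instance (Λ : Type u) [Ring Λ] [Algebra k Λ] [Module.Finite k Λ] :
    Category.{u} (FGRightMod k Λ) :=
  inferInstanceAs (Category.{u} (FGModuleCat.{u} Λᵐᵒᵖ))

theorem isNoetherianRing_mulOpposite (Λ : Type u) [Ring Λ] [Algebra k Λ] [Module.Finite k Λ] :
    IsNoetherianRing Λᵐᵒᵖ :=
  haveI := finite_mulOpposite k Λ
  isNoetherian_of_tower k (inferInstance : IsNoetherian k Λᵐᵒᵖ)

instance (Λ : Type u) [Ring Λ] [Algebra k Λ] [Module.Finite k Λ] : Abelian (FGRightMod k Λ) :=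
  haveI := isNoetherianRing_mulOpposite k Λ
  inferInstanceAs (Abelian (FGModuleCat.{u} Λᵐᵒᵖ))

instance (Λ : Type u) [Ring Λ] [Algebra k Λ] [Module.Finite k Λ] :
    HasExt.{u + 1} (FGRightMod k Λ) :=
  HasExt.standard _

variable {k}
variable {Λ Λ' : Type u} [Ring Λ] [Algebra k Λ] [Module.Finite k Λ]
  [Ring Λ'] [Algebra k Λ'] [Module.Finite k Λ']

/-- Restriction of scalars `φ_* : mod-Λ' ⥤ mod-Λ` along a `k`-algebra homomorphism. -/
def restrict (φ : Λ →ₐ[k] Λ') : FGRightMod k Λ' ⥤ FGRightMod k Λ :=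
  ObjectProperty.lift (ModuleCat.isFG Λᵐᵒᵖ)
    ((ModuleCat.isFG Λ'ᵐᵒᵖ).ι ⋙ ModuleCat.restrictScalars (RingHom.op (φ : Λ →+* Λ')))
    (finite_restrictScalars k φ)

/-- The inclusion of `mod-Λ` into the category of all right modules. -/
def toModuleCat (k : Type w) [CommRing k] [IsArtinianRing k]
    (Λ : Type u) [Ring Λ] [Algebra k Λ] [Module.Finite k Λ] :
    FGRightMod k Λ ⥤ ModuleCat.{u} Λᵐᵒᵖ :=
  (ModuleCat.isFG Λᵐᵒᵖ).ι

instance : (toModuleCat k Λ).Full := inferInstanceAs (ModuleCat.isFG Λᵐᵒᵖ).ι.Full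
instance : (toModuleCat k Λ).Faithful := inferInstanceAs (ModuleCat.isFG Λᵐᵒᵖ).ι.Faithful

instance : PreservesFiniteLimits (toModuleCat k Λ) :=
  haveI := isNoetherianRing_mulOpposite k Λ
  inferInstanceAs (PreservesFiniteLimits (forget₂ (FGModuleCat.{u} Λᵐᵒᵖ) (ModuleCat.{u} Λᵐᵒᵖ)))

instance : PreservesFiniteColimits (toModuleCat k Λ) :=
  haveI := isNoetherianRing_mulOpposite k Λ
  inferInstanceAs (PreservesFiniteColimits (forget₂ (FGModuleCat.{u} Λᵐᵒᵖ) (ModuleCat.{u} Λᵐᵒᵖ)))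

instance (φ : Λ →ₐ[k] Λ') : (restrict φ).Additive where
  map_add := rfl

instance (φ : Λ →ₐ[k] Λ') : PreservesFiniteLimits (restrict φ) :=
  haveI := (restrictScalars_exact (RingHom.op (φ : Λ →+* Λ'))).1
  haveI : PreservesFiniteLimits (restrict φ ⋙ toModuleCat k Λ) :=
    comp_preservesFiniteLimits (toModuleCat k Λ')
      (ModuleCat.restrictScalars (RingHom.op (φ : Λ →+* Λ')))
  preservesFiniteLimits_of_reflects_of_preserves (restrict φ) (toModuleCat k Λ)

instance (φ : Λ →ₐ[k] Λ') : PreservesFiniteColimits (restrict φ) :=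
  haveI := (restrictScalars_exact (RingHom.op (φ : Λ →+* Λ'))).2
  haveI : PreservesFiniteColimits (restrict φ ⋙ toModuleCat k Λ) :=
    comp_preservesFiniteColimits (toModuleCat k Λ')
      (ModuleCat.restrictScalars (RingHom.op (φ : Λ →+* Λ')))
  preservesFiniteColimits_of_reflects_of_preserves (restrict φ) (toModuleCat k Λ)

/-- `(Λ, M)` is an `n`-homological pair. -/
def IsNHomologicalPair (n : ℕ) (M : ObjectProperty (FGRightMod k Λ)) : Prop :=
  IsNClusterTilting.{u + 1} n M

/-- The algebra homomorphism `φ : Λ ⟶ Λ'` is an epimorphism of `n`-homological pairs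
`(Λ, M) ⟶ (Λ', M')`. -/
structure IsEpiOfNHomologicalPairs (n : ℕ) (M : ObjectProperty (FGRightMod k Λ))
    (M' : ObjectProperty (FGRightMod k Λ')) (φ : Λ →ₐ[k] Λ') : Prop where
  source : IsNHomologicalPair n M
  target : IsNHomologicalPair n M'
  map_le : M'.map (restrict φ) ≤ M
  epi : Epi (RingCat.ofHom (φ : Λ →+* Λ'))

end Modules

end HigherHomological

end

open HigherHomological

-- The ring epimorphism makes `restrict φ` fully faithful, so the essential image of `M'` is
-- equivalent to `M'`; both claims then become statements about `M'`, transported along the functor.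
--
-- The first is Jasso's theorem that an `n`-cluster tilting subcategory is `n`-abelian. Given `f` in
-- `M`, take its cokernel in the abelian category, embed it in `M` by a preenvelope, and repeat.
-- Each step makes `Ext^i(-, M)` of the cokernel vanish in one more degree, so after `n - 1` further
-- steps the cokernel lies in `M` and the sequence ends as an `n`-cokernel. If `f` is mono, shifting
-- `Ext^i(M, -)` along the same short exact sequences shows that maps from `M` lift where an
-- `n`-kernel needs it (`isNatNCokernel`, `isNatNKernel`). Kernels and epimorphisms follow by
-- passing to the opposite category.
--
-- The second holds because the bijections on `Ext^n` are natural in the second variable, so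
-- `restrict φ` preserves and reflects the exactness conditions defining cotorsion classes, and
-- every sequence in the image lifts to `M'` (`IsNCotorsionClass.map`).

universe v' u'

namespace HigherHomological

/-! ### Sequences indexed by `ℕ`, and their truncations -/

section Sequences

variable {C : Type u} [Category.{v} C]

/-- The truncation to `n + 2` objects of a functor defined on `ℕ`. -/
def truncSeq (n : ℕ) (F : ℕ ⥤ C) : ComposableArrows C (n + 1) :=
  Monotone.functor (f := fun i : Fin (n + 2) => i.val) (fun _ _ h => h) ⋙ F

/-- The truncation to `n + 2` objects of a functor defined on `ℕᵒᵖ`. -/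
def truncOpSeq (n : ℕ) (F : ℕᵒᵖ ⥤ C) : ComposableArrows C (n + 1) where
  obj i := F.obj (.op (n + 1 - i.val))
  map h := F.map (homOfLE (Nat.sub_le_sub_left (leOfHom h) _)).op
  map_id _ := F.map_id _
  map_comp _ _ := F.map_comp _ _

theorem nonempty_iso_truncSeq (n : ℕ) {X : ℕ → C} (d : ∀ i, X i ⟶ X (i + 1)) :
    Nonempty (Arrow.mk ((truncSeq n (Functor.ofSequence d)).map' 0 1) ≅ Arrow.mk (d 0)) :=
  ⟨eqToIso (congrArg Arrow.mk (Functor.ofSequence_map_homOfLE_succ d 0))⟩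

theorem leftOp_ofSequence_map {X : ℕ → Cᵒᵖ} {d : ∀ i, X i ⟶ X (i + 1)} (i : ℕ) :
    (Functor.ofSequence d).leftOp.map (homOfLE (Nat.le_add_right i 1)).op = (d i).unop :=
  congrArg Quiver.Hom.unop (Functor.ofSequence_map_homOfLE_succ d i)

theorem nonempty_iso_truncOpSeq {X : ℕ → Cᵒᵖ} {d : ∀ i, X i ⟶ X (i + 1)} (n : ℕ) :
    Nonempty (Arrow.mk ((truncOpSeq n (Functor.ofSequence d).leftOp).map' n (n + 1)) ≅
      Arrow.mk (d 0).unop) := by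
  -- The indices are truncated differences such as `n + 1 - i`; replacing them by variables lets
  -- `subst` turn the map into a single step of the sequence.
  have key (p q : ℕ) (hp : p = 0) (hq : p + 1 = q) : Nonempty
      (Arrow.mk ((Functor.ofSequence d).leftOp.map (homOfLE (show p ≤ q by lia)).op) ≅
        Arrow.mk (d 0).unop) := by
    subst hp hq
    exact ⟨eqToIso (congrArg Arrow.mk (leftOp_ofSequence_map 0))⟩
  exact key (n + 1 - (n + 1)) (n + 1 - n) (by lia) (by lia)

variable [Preadditive C]

/-- The maps `d 1, …, d n` of a sequence form an `n`-cokernel of `d 0`, and all the later maps are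
still exact after applying `Hom(-, m)`. -/
structure IsNatNCokernel (n : ℕ) {X : ℕ → C} (d : ∀ i, X i ⟶ X (i + 1)) : Prop where
  injective {m : C} (g g' : X (n + 1) ⟶ m) : d n ≫ g = d n ≫ g' → g = g'
  exact (i : ℕ) {m : C} (g : X (i + 1) ⟶ m) : d i ≫ g = 0 ↔ ∃ h, d (i + 1) ≫ h = g

/-- The maps `d 0, …, d (n - 1)` of a sequence form an `n`-kernel of `d n`. -/
structure IsNatNKernel (n : ℕ) {X : ℕ → C} (d : ∀ i, X i ⟶ X (i + 1)) : Prop where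
  injective {m : C} (g g' : m ⟶ X 0) : g ≫ d 0 = g' ≫ d 0 → g = g'
  exact (i : ℕ) (hi : i + 1 ≤ n) {m : C} (g : m ⟶ X (i + 1)) :
    g ≫ d (i + 1) = 0 ↔ ∃ h, h ≫ d i = g

theorem IsNatNCokernel.isNCokernelSeq {n : ℕ} {X : ℕ → C} {d : ∀ i, X i ⟶ X (i + 1)}
    (hd : IsNatNCokernel n d) : IsNCokernelSeq (truncSeq n (Functor.ofSequence d)) where
  injective m g g' h := by
    have e : (truncSeq n (Functor.ofSequence d)).map' n (n + 1) = d n :=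
      Functor.ofSequence_map_homOfLE_succ d n
    simp only [e] at h
    exact hd.injective (m := m) g g' h
  exact m i hi g := by
    have e : (truncSeq n (Functor.ofSequence d)).map' i (i + 1) = d i :=
      Functor.ofSequence_map_homOfLE_succ d i
    have e' : (truncSeq n (Functor.ofSequence d)).map' (i + 1) (i + 2) = d (i + 1) :=
      Functor.ofSequence_map_homOfLE_succ d (i + 1)
    simp only [e, e']
    exact hd.exact i g

theorem IsNatNKernel.isNKernelSeq {n : ℕ} {X : ℕ → C} {d : ∀ i, X i ⟶ X (i + 1)}
    (hd : IsNatNKernel n d) : IsNKernelSeq (truncSeq n (Functor.ofSequence d)) where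
  injective m g g' h := by
    have e : (truncSeq n (Functor.ofSequence d)).map' 0 1 = d 0 :=
      Functor.ofSequence_map_homOfLE_succ d 0
    simp only [e] at h
    exact hd.injective (m := m) g g' h
  exact m i hi g := by
    have e : (truncSeq n (Functor.ofSequence d)).map' i (i + 1) = d i :=
      Functor.ofSequence_map_homOfLE_succ d i
    have e' : (truncSeq n (Functor.ofSequence d)).map' (i + 1) (i + 2) = d (i + 1) :=
      Functor.ofSequence_map_homOfLE_succ d (i + 1)
    simp only [e, e']
    exact hd.exact i (by lia) g

section Op

variable {X : ℕ → Cᵒᵖ} {d : ∀ i, X i ⟶ X (i + 1)}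

theorem IsNatNCokernel.isNKernelSeq_op {n : ℕ} (hd : IsNatNCokernel n d) :
    IsNKernelSeq (truncOpSeq n (Functor.ofSequence d).leftOp) where
  injective m := by
    have key (p q : ℕ) (hp : p = n) (hq : p + 1 = q) : Function.Injective
        (fun g : m ⟶ (Functor.ofSequence d).leftOp.obj (.op q) =>
          g ≫ (Functor.ofSequence d).leftOp.map (homOfLE (show p ≤ q by lia)).op) := by
      subst hp hq
      intro g g' h
      simp only [leftOp_ofSequence_map] at h
      exact Quiver.Hom.op_inj (hd.injective g.op g'.op (Quiver.Hom.unop_inj h))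
    exact key (n + 1 - 1) (n + 1 - 0) (by lia) (by lia)
  exact m i hi := by
    have key (p q r : ℕ) (hq : p + 1 = q) (hr : q + 1 = r) : Function.Exact
        (fun g : m ⟶ (Functor.ofSequence d).leftOp.obj (.op r) =>
          g ≫ (Functor.ofSequence d).leftOp.map (homOfLE (show q ≤ r by lia)).op)
        (fun g : m ⟶ (Functor.ofSequence d).leftOp.obj (.op q) =>
          g ≫ (Functor.ofSequence d).leftOp.map (homOfLE (show p ≤ q by lia)).op) := by
      subst hq hr
      intro g
      simp only [leftOp_ofSequence_map]
      refine ⟨fun h => ?_, ?_⟩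
      · obtain ⟨h', e⟩ := (hd.exact p g.op).1 (Quiver.Hom.unop_inj h)
        exact ⟨h'.unop, Quiver.Hom.op_inj e⟩
      · rintro ⟨h', rfl⟩
        exact Quiver.Hom.op_inj ((hd.exact p _).2 ⟨h'.op, rfl⟩)
    exact key (n + 1 - (i + 2)) (n + 1 - (i + 1)) (n + 1 - i) (by lia) (by lia)

theorem IsNatNKernel.isNCokernelSeq_op {n : ℕ} (hd : IsNatNKernel n d) :
    IsNCokernelSeq (truncOpSeq n (Functor.ofSequence d).leftOp) where
  injective m := by
    have key (p q : ℕ) (hp : p = 0) (hq : p + 1 = q) : Function.Injective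
        (fun g : (Functor.ofSequence d).leftOp.obj (.op p) ⟶ m =>
          (Functor.ofSequence d).leftOp.map (homOfLE (show p ≤ q by lia)).op ≫ g) := by
      subst hp hq
      intro g g' h
      simp only [leftOp_ofSequence_map] at h
      exact Quiver.Hom.op_inj (hd.injective g.op g'.op (Quiver.Hom.unop_inj h))
    exact key (n + 1 - (n + 1)) (n + 1 - n) (by lia) (by lia)
  exact m i hi := by
    have key (p q r : ℕ) (hq : p + 1 = q) (hr : q + 1 = r) (hrn : r ≤ n + 1) : Function.Exact
        (fun g : (Functor.ofSequence d).leftOp.obj (.op p) ⟶ m =>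
          (Functor.ofSequence d).leftOp.map (homOfLE (show p ≤ q by lia)).op ≫ g)
        (fun g : (Functor.ofSequence d).leftOp.obj (.op q) ⟶ m =>
          (Functor.ofSequence d).leftOp.map (homOfLE (show q ≤ r by lia)).op ≫ g) := by
      subst hq hr
      intro g
      simp only [leftOp_ofSequence_map]
      refine ⟨fun h => ?_, ?_⟩
      · obtain ⟨h', e⟩ := (hd.exact p (by lia) g.op).1 (Quiver.Hom.unop_inj h)
        exact ⟨h'.unop, Quiver.Hom.op_inj e⟩
      · rintro ⟨h', rfl⟩
        exact Quiver.Hom.op_inj ((hd.exact p (by lia) _).2 ⟨h'.op, rfl⟩)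
    exact key (n + 1 - (i + 2)) (n + 1 - (i + 1)) (n + 1 - i) (by lia) (by lia) (by lia)

end Op

end Sequences

/-! ### Iterated preenvelopes of cokernels -/

section Resolving

variable {A : Type u} [Category.{v} A] [Abelian A]

/-- The properties of the vanishing of `Ext^i(-, M)` (property `L i`) and of `Ext^i(M, -)`
(property `R i`) for an `n`-cluster tilting subcategory `M` which enter in the construction of
`n`-cokernels. -/
structure IsVanishing (n : ℕ) (M : ObjectProperty A) (L R : ℕ → ObjectProperty A) : Prop where
  isGenerating : IsGenerating M
  exists_mono (a : A) : ∃ (m : A) (j : a ⟶ m), M m ∧ Mono j ∧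
    ∀ (m' : A) (g : a ⟶ m'), M m' → ∃ h : m ⟶ m', j ≫ h = g
  prop_of_left (c : A) : (∀ i, 0 < i → i < n → L i c) → M c
  left (c : A) : M c → ∀ i, 0 < i → i < n → L i c
  right (c : A) : M c → ∀ i, 0 < i → i < n → R i c
  left_one (S : ShortComplex A) : S.ShortExact → L 1 S.X₂ →
    (∀ (m : A) (g : S.X₁ ⟶ m), M m → ∃ h, S.f ≫ h = g) → L 1 S.X₃
  left_succ (i : ℕ) (S : ShortComplex A) : 0 < i → S.ShortExact → L i S.X₁ → L (i + 1) S.X₂ →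
    L (i + 1) S.X₃
  exists_lift (S : ShortComplex A) : S.ShortExact → R 1 S.X₁ →
    ∀ (m : A) (g : m ⟶ S.X₃), M m → ∃ h, h ≫ S.g = g
  right_succ (i : ℕ) (S : ShortComplex A) : 0 < i → S.ShortExact → R i S.X₂ → R (i + 1) S.X₁ →
    R i S.X₃

variable {C : Type u'} [Category.{v'} C]

/-- A sequence in `C` obtained from its first map by iterating preenvelopes of cokernels. -/
def IsIteratedPreenvelope (G : C ⥤ A) (M : ObjectProperty A) {X : ℕ → C}
    (d : ∀ i, X i ⟶ X (i + 1)) : Prop :=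
  ∀ i, ∃ ι : cokernel (G.map (d i)) ⟶ G.obj (X (i + 2)),
    G.map (d (i + 1)) = cokernel.π (G.map (d i)) ≫ ι ∧ Mono ι ∧
      (∀ (m : A) (g : cokernel (G.map (d i)) ⟶ m), M m → ∃ h, ι ≫ h = g) ∧
      (M (cokernel (G.map (d i))) → IsIso ι)

/-- The sequence of arrows obtained by iterating a choice of maps from cokernels to objects
of `C`. -/
noncomputable def iterateCokernel (G : C ⥤ A) [G.Full] (Y : A → C) (j : ∀ a, a ⟶ G.obj (Y a)) (f : Arrow C) :
    ℕ → Arrow C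
  | 0 => f
  | i + 1 => Arrow.mk (G.preimage
      (cokernel.π (G.map (iterateCokernel G Y j f i).hom) ≫ j (cokernel (G.map _))))

variable {n : ℕ} {M : ObjectProperty A} {L R : ℕ → ObjectProperty A}
variable (G : C ⥤ A)

theorem IsVanishing.exists_isIteratedPreenvelope [G.Full] (h : IsVanishing n M L R)
    (hG : ∀ a, M a → ∃ c, Nonempty (G.obj c ≅ a)) {a b : C} (f : a ⟶ b) :
    ∃ (X : ℕ → C) (d : ∀ i, X i ⟶ X (i + 1)),
      Arrow.mk (d 0) = Arrow.mk f ∧ IsIteratedPreenvelope G M d := by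
  have key (a : A) : ∃ (c : C) (j : a ⟶ G.obj c), Mono j ∧
      (∀ (m : A) (g : a ⟶ m), M m → ∃ h, j ≫ h = g) ∧ (M a → IsIso j) := by
    -- A preenvelope of an object of `M` is in general only a split mono. An isomorphism is chosen
    -- in that case so that the sequence terminates once a cokernel lies in `M`.
    by_cases ha : M a
    · obtain ⟨c, ⟨e⟩⟩ := hG a ha
      exact ⟨c, e.inv, inferInstance, fun m g _ => ⟨e.hom ≫ g, by simp⟩, fun _ => inferInstance⟩
    · obtain ⟨m, j, hm, hj, hj'⟩ := h.exists_mono a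
      obtain ⟨c, ⟨e⟩⟩ := hG m hm
      refine ⟨c, j ≫ e.inv, mono_comp _ _, fun m' g hm' => ?_, fun ha' => (ha ha').elim⟩
      obtain ⟨g', hg'⟩ := hj' m' g hm'
      exact ⟨e.hom ≫ g', by simpa using hg'⟩
  choose Y j hj hj' hj'' using key
  refine ⟨fun i => (iterateCokernel G Y j (Arrow.mk f) i).left,
    fun i => (iterateCokernel G Y j (Arrow.mk f) i).hom, rfl, fun i => ⟨j _, ?_, hj _, hj' _, hj'' _⟩⟩
  exact G.map_preimage _

namespace IsIteratedPreenvelope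

variable {G} {X : ℕ → C} {d : ∀ i, X i ⟶ X (i + 1)} (hd : IsIteratedPreenvelope G M d)

/-- The mono from the cokernel of a map of the sequence to the target of the next one. -/
noncomputable def ι (hd : IsIteratedPreenvelope G M d) (i : ℕ) :
    cokernel (G.map (d i)) ⟶ G.obj (X (i + 2)) := (hd i).choose

theorem map_d_succ (i : ℕ) : G.map (d (i + 1)) = cokernel.π (G.map (d i)) ≫ hd.ι i :=
  (hd i).choose_spec.1

theorem mono_ι (i : ℕ) : Mono (hd.ι i) := (hd i).choose_spec.2.1

theorem exists_desc (i : ℕ) (m : A) (hm : M m) (g : cokernel (G.map (d i)) ⟶ m) :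
    ∃ h, hd.ι i ≫ h = g :=
  (hd i).choose_spec.2.2.1 m g hm

theorem isIso_ι (i : ℕ) (h : M (cokernel (G.map (d i)))) : IsIso (hd.ι i) :=
  (hd i).choose_spec.2.2.2 h

theorem ι_π (i : ℕ) : hd.ι i ≫ cokernel.π (G.map (d (i + 1))) = 0 := by
  rw [← cancel_epi (cokernel.π (G.map (d i))), ← Category.assoc, ← hd.map_d_succ]
  simp

/-- As `d (i + 1)` is an epi followed by `ι i`, the two have the same cokernel. These short exact
sequences link consecutive cokernels and carry all the dimension shifting. -/
theorem shortExact_ι_π (i : ℕ) : (ShortComplex.mk _ _ (hd.ι_π i)).ShortExact where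
  exact := by
    refine ShortComplex.exact_of_g_is_cokernel _ (CokernelCofork.IsColimit.ofπ' _ _ fun k hk => ?_)
    refine ⟨cokernel.desc _ k ?_, cokernel.π_desc _ _ _⟩
    rw [hd.map_d_succ, Category.assoc, hk, comp_zero]
  mono_f := hd.mono_ι i
  epi_g := inferInstanceAs (Epi (cokernel.π _))

theorem shortExact_zero (h0 : Mono (G.map (d 0))) :
    (ShortComplex.mk _ _ (cokernel.condition (G.map (d 0)))).ShortExact where
  exact := ShortComplex.exact_of_g_is_cokernel _ (cokernelIsCokernel _)
  mono_f := h0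
  epi_g := inferInstanceAs (Epi (cokernel.π _))

include hd

/-- Dimension shifting: degree 1 comes from the preenvelope property, and each degree above 1 from
the degree below for the previous cokernel. -/
theorem left_cokernel (h : IsVanishing n M L R) (hG : ∀ c, M (G.obj c)) (i l : ℕ) (hl : 0 < l)
    (hli : l ≤ i) (hln : l < n) : L l (cokernel (G.map (d i))) := by
  induction i generalizing l with
  | zero => lia
  | succ i ih =>
    obtain _ | _ | l := l
    · lia
    · exact h.left_one _ (hd.shortExact_ι_π i) (h.left _ (hG _) _ hl hln)
        (fun m g hm => hd.exists_desc i m hm g)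
    · exact h.left_succ _ _ (by lia) (hd.shortExact_ι_π i)
        (ih (l + 1) (by lia) (by lia) (by lia)) (h.left _ (hG _) _ hl hln)

/-- Each further cokernel costs one degree of vanishing, starting from degrees below `n` for objects
of `M`; hence the bound `l + i + 1 < n`. -/
theorem right_cokernel (h : IsVanishing n M L R) (hG : ∀ c, M (G.obj c)) (h0 : Mono (G.map (d 0)))
    (i l : ℕ) (hl : 0 < l) (hln : l + i + 1 < n) : R l (cokernel (G.map (d i))) := by
  induction i generalizing l with
  | zero =>
    exact h.right_succ _ _ hl (shortExact_zero h0) (h.right _ (hG _) _ hl (by lia))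
      (h.right _ (hG _) _ (by lia) (by lia))
  | succ i ih =>
    exact h.right_succ _ _ hl (hd.shortExact_ι_π i) (h.right _ (hG _) _ hl (by lia))
      (ih (l + 1) (by lia) (by lia))

theorem exists_lift_π (h : IsVanishing n M L R) (hG : ∀ c, M (G.obj c)) (h0 : Mono (G.map (d 0)))
    (i : ℕ) (hi : i + 1 < n) (m : A) (hm : M m) (g : m ⟶ cokernel (G.map (d i))) :
    ∃ k, k ≫ cokernel.π (G.map (d i)) = g := by
  obtain _ | i := i
  · exact h.exists_lift _ (shortExact_zero h0) (h.right _ (hG _) 1 (by lia) (by lia)) m g hm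
  · exact h.exists_lift _ (hd.shortExact_ι_π i)
      (hd.right_cokernel h hG h0 i 1 (by lia) (by lia)) m g hm

variable [Preadditive C]

theorem isNatNCokernel [G.Full] [G.Faithful] [G.Additive] (hn : 1 ≤ n) (h : IsVanishing n M L R)
    (hG : ∀ c, M (G.obj c)) : IsNatNCokernel n d where
  injective {m} g g' hg := by
    obtain ⟨n, rfl⟩ : ∃ k, n = k + 1 := ⟨n - 1, by lia⟩
    -- Here `n` is one less than the original. The cokernel of `d n` has all the vanishing required
    -- to lie in `M`, so `ι n` is invertible and `d (n + 1)` becomes epi.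
    have := hd.isIso_ι n (h.prop_of_left _ fun i hi hi' =>
      hd.left_cokernel h hG n i hi (by lia) hi')
    apply G.map_injective
    rw [← cancel_epi (hd.ι n), ← cancel_epi (cokernel.π (G.map (d n))), ← Category.assoc,
      ← hd.map_d_succ, ← G.map_comp, hg, G.map_comp, hd.map_d_succ, Category.assoc]
  exact i {m} g := by
    constructor
    · intro hg
      obtain ⟨k, hk⟩ := hd.exists_desc i (G.obj m) (hG m)
        (cokernel.desc _ (G.map g) (by rw [← G.map_comp, hg, G.map_zero]))
      refine ⟨G.preimage k, G.map_injective ?_⟩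
      rw [G.map_comp, G.map_preimage, hd.map_d_succ, Category.assoc, hk, cokernel.π_desc]
    · rintro ⟨k, rfl⟩
      apply G.map_injective
      rw [G.map_comp, G.map_comp, hd.map_d_succ, Category.assoc, cokernel.condition_assoc, zero_comp,
        G.map_zero]

theorem isNatNKernel [G.Full] [G.Faithful] [G.Additive] (h : IsVanishing n M L R)
    (hG : ∀ c, M (G.obj c)) (h0 : Mono (G.map (d 0))) : IsNatNKernel n d where
  injective {m} g g' hg := by
    apply G.map_injective
    rw [← cancel_mono (G.map (d 0)), ← G.map_comp, hg, G.map_comp]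
  exact i hi {m} g := by
    constructor
    · intro hg
      have hg' : G.map g ≫ cokernel.π (G.map (d i)) = 0 := by
        have := hd.mono_ι i
        rw [← cancel_mono (hd.ι i), Category.assoc, ← hd.map_d_succ, ← G.map_comp, hg]
        simp
      have hmono := hd.mono_ι
      obtain ⟨k, hk⟩ : ∃ k, k ≫ G.map (d i) = G.map g := by
        -- The mono `d 0` is the kernel of its cokernel. Later, `g` first factors through the mono
        -- `ι i`, and this factor lifts along the cokernel projection by `exists_lift_π`.
        obtain _ | i := i
        · exact ⟨_, (shortExact_zero h0).exact.lift_f (G.map g) hg'⟩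
        · obtain ⟨k, hk⟩ := hd.exists_lift_π h hG h0 i (by lia) _ (hG m)
            ((hd.shortExact_ι_π i).exact.lift (G.map g) hg')
          refine ⟨k, ?_⟩
          rw [hd.map_d_succ, ← Category.assoc, hk]
          exact (hd.shortExact_ι_π i).exact.lift_f _ _
      exact ⟨G.preimage k, G.map_injective (by simp [hk])⟩
    · rintro ⟨k, rfl⟩
      apply G.map_injective
      rw [G.map_comp, G.map_comp, hd.map_d_succ, Category.assoc, cokernel.condition_assoc, zero_comp,
        comp_zero, G.map_zero]

end IsIteratedPreenvelope

variable {G}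

variable [Preadditive C]

/-- Since `M` is generating, a map killed by `G.map f` can be tested after covering its source by an
object of `M`, where `f` is already mono. -/
theorem IsVanishing.mono_map [G.Full] [G.Faithful] [G.Additive] (h : IsVanishing n M L R)
    (hG : ∀ a, M a → ∃ c, Nonempty (G.obj c ≅ a)) {a b : C} (f : a ⟶ b) [Mono f] :
    Mono (G.map f) := by
  refine Preadditive.mono_of_cancel_zero _ fun {x} g hg => ?_
  obtain ⟨m, p, hm, hp⟩ := h.isGenerating x
  obtain ⟨c, ⟨e⟩⟩ := hG m hm
  have h0 : G.preimage (e.hom ≫ p ≫ g) = 0 := by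
    rw [← cancel_mono f]
    apply G.map_injective
    simp [hg]
  have h1 : e.hom ≫ p ≫ g = 0 := by rw [← G.map_preimage (e.hom ≫ p ≫ g), h0, G.map_zero]
  rwa [← cancel_epi p, ← cancel_epi e.hom, comp_zero, comp_zero]

theorem IsVanishing.exists_natSequence [G.Full] [G.Faithful] [G.Additive] (hn : 1 ≤ n)
    (h : IsVanishing n M L R) (hG : ∀ c, M (G.obj c))
    (hG' : ∀ a, M a → ∃ c, Nonempty (G.obj c ≅ a)) {a b : C} (f : a ⟶ b) :
    ∃ (X : ℕ → C) (d : ∀ i, X i ⟶ X (i + 1)), Arrow.mk (d 0) = Arrow.mk f ∧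
      IsNatNCokernel n d ∧ (Mono f → IsNatNKernel n d) := by
  obtain ⟨X, d, e, hd⟩ := h.exists_isIteratedPreenvelope G hG' f
  refine ⟨X, d, e, hd.isNatNCokernel hn h hG, fun hf => hd.isNatNKernel h hG ?_⟩
  have : Mono (d 0) :=
    ((MorphismProperty.monomorphisms C).arrow_mk_iso_iff (eqToIso e)).2 hf
  exact h.mono_map hG' (d 0)

end Resolving

/-! ### Long exact sequences of `Ext` and vanishing for cluster tilting subcategories -/

section ExtVanishing

open Abelian

variable {A : Type u} [Category.{v} A] [Abelian A] [HasExt.{w} A]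
variable {S : ShortComplex A} (hS : S.ShortExact) (Y : A) (i : ℕ)

theorem subsingleton_ext_X₃_of_comp_eq_zero
    (h₁ : ∀ x : Ext.{w} S.X₁ Y i, hS.extClass.comp x (add_comm 1 i) = 0)
    (h₂ : Subsingleton (Ext.{w} S.X₂ Y (i + 1))) : Subsingleton (Ext.{w} S.X₃ Y (i + 1)) :=
  subsingleton_of_forall_eq 0 fun x => by
    obtain ⟨y, rfl⟩ := Ext.contravariant_sequence_exact₃ hS Y x (Subsingleton.elim _ _)
      (add_comm 1 i)
    exact h₁ y

theorem subsingleton_ext_X₁_of_comp_eq_zero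
    (h₁ : ∀ x : Ext.{w} Y S.X₃ i, x.comp hS.extClass rfl = 0)
    (h₂ : Subsingleton (Ext.{w} Y S.X₂ (i + 1))) : Subsingleton (Ext.{w} Y S.X₁ (i + 1)) :=
  subsingleton_of_forall_eq 0 fun x => by
    obtain ⟨y, rfl⟩ := Ext.covariant_sequence_exact₁ Y hS x (Subsingleton.elim _ _) rfl
    exact h₁ y

include hS

theorem subsingleton_ext_X₃_succ (h₁ : Subsingleton (Ext.{w} S.X₁ Y i))
    (h₂ : Subsingleton (Ext.{w} S.X₂ Y (i + 1))) : Subsingleton (Ext.{w} S.X₃ Y (i + 1)) :=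
  subsingleton_ext_X₃_of_comp_eq_zero hS Y i
    (fun x => by rw [Subsingleton.elim x 0, Ext.comp_zero]) h₂

theorem subsingleton_ext_X₁_succ (h₁ : Subsingleton (Ext.{w} Y S.X₃ i))
    (h₂ : Subsingleton (Ext.{w} Y S.X₂ (i + 1))) : Subsingleton (Ext.{w} Y S.X₁ (i + 1)) :=
  subsingleton_ext_X₁_of_comp_eq_zero hS Y i
    (fun x => by rw [Subsingleton.elim x 0, Ext.zero_comp]) h₂

/-- If every map from `S.X₁` extends to `S.X₂`, the connecting map out of `Hom(S.X₁, Y)` is zero. -/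
theorem subsingleton_ext_X₃_one (h : ∀ g : S.X₁ ⟶ Y, ∃ h, S.f ≫ h = g)
    (h₂ : Subsingleton (Ext.{w} S.X₂ Y 1)) : Subsingleton (Ext.{w} S.X₃ Y 1) := by
  refine subsingleton_ext_X₃_of_comp_eq_zero hS Y 0 (fun x => ?_) h₂
  obtain ⟨g, rfl⟩ := (Ext.mk₀_bijective _ _).2 x
  obtain ⟨k, rfl⟩ := h g
  rw [← Ext.mk₀_comp_mk₀]
  exact hS.extClass_comp_assoc _

theorem subsingleton_ext_X₁_one (h : ∀ g : Y ⟶ S.X₃, ∃ h, h ≫ S.g = g)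
    (h₂ : Subsingleton (Ext.{w} Y S.X₂ 1)) : Subsingleton (Ext.{w} Y S.X₁ 1) := by
  refine subsingleton_ext_X₁_of_comp_eq_zero hS Y 0 (fun x => ?_) h₂
  obtain ⟨g, rfl⟩ := (Ext.mk₀_bijective _ _).2 x
  obtain ⟨k, rfl⟩ := h g
  rw [← Ext.mk₀_comp_mk₀, Ext.comp_assoc_of_second_deg_zero, hS.comp_extClass, Ext.comp_zero]

theorem subsingleton_ext_X₃ (h₂ : Subsingleton (Ext.{w} Y S.X₂ i))
    (h₁ : Subsingleton (Ext.{w} Y S.X₁ (i + 1))) : Subsingleton (Ext.{w} Y S.X₃ i) :=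
  subsingleton_of_forall_eq 0 fun x => by
    obtain ⟨y, rfl⟩ := Ext.covariant_sequence_exact₃ Y hS x rfl (Subsingleton.elim _ _)
    rw [Subsingleton.elim y 0, Ext.zero_comp]

theorem subsingleton_ext_X₁ (h₂ : Subsingleton (Ext.{w} S.X₂ Y i))
    (h₁ : Subsingleton (Ext.{w} S.X₃ Y (i + 1))) : Subsingleton (Ext.{w} S.X₁ Y i) :=
  subsingleton_of_forall_eq 0 fun x => by
    obtain ⟨y, rfl⟩ := Ext.contravariant_sequence_exact₁ hS Y x (add_comm 1 i)
      (Subsingleton.elim _ _)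
    rw [Subsingleton.elim y 0, Ext.comp_zero]

variable {Y}

theorem exists_lift_of_subsingleton_ext (h₁ : Subsingleton (Ext.{w} Y S.X₁ 1)) (g : Y ⟶ S.X₃) :
    ∃ h, h ≫ S.g = g := by
  obtain ⟨y, hy⟩ := Ext.covariant_sequence_exact₃ Y hS (Ext.mk₀ g) rfl (Subsingleton.elim _ _)
  obtain ⟨h, rfl⟩ := (Ext.mk₀_bijective _ _).2 y
  rw [Ext.mk₀_comp_mk₀] at hy
  exact ⟨h, (Ext.mk₀_bijective _ _).1 hy⟩

theorem exists_desc_of_subsingleton_ext (h₁ : Subsingleton (Ext.{w} S.X₃ Y 1)) (g : S.X₁ ⟶ Y) :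
    ∃ h, S.f ≫ h = g := by
  obtain ⟨y, hy⟩ := Ext.contravariant_sequence_exact₁ hS Y (Ext.mk₀ g) rfl (Subsingleton.elim _ _)
  obtain ⟨h, rfl⟩ := (Ext.mk₀_bijective _ _).2 y
  rw [Ext.mk₀_comp_mk₀] at hy
  exact ⟨h, (Ext.mk₀_bijective _ _).1 hy⟩

omit hS

variable (M : ObjectProperty A)

/-- Objects `c` such that `Ext^i(c, M) = 0`. -/
def leftVanishing (i : ℕ) : ObjectProperty A :=
  fun c => ∀ m : A, M m → Subsingleton (Ext.{w} c m i)

/-- Objects `c` such that `Ext^i(M, c) = 0`. -/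
def rightVanishing (i : ℕ) : ObjectProperty A :=
  fun c => ∀ m : A, M m → Subsingleton (Ext.{w} m c i)

variable {M} {n : ℕ}

theorem IsNClusterTilting.subsingleton_ext (hM : IsNClusterTilting.{w} n M) {a b : A} (ha : M a)
    (hb : M b) {i : ℕ} (hi : 0 < i) (hin : i < n) : Subsingleton (Ext.{w} a b i) := by
  have h := hM.rightPerp_eq
  rw [← h] at hb
  exact hb a ha i hi hin

theorem IsNClusterTilting.isVanishing (hM : IsNClusterTilting.{w} n M) :
    IsVanishing n M (leftVanishing.{w} M) (rightVanishing.{w} M) where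
  isGenerating := hM.isGenerating
  exists_mono a := by
    obtain ⟨m, j, hm, hj⟩ := hM.isPreenveloping a
    obtain ⟨m', j', hm', hj'⟩ := hM.isCogenerating a
    -- The embedding into an object of `M` factors through the preenvelope, which is therefore mono.
    obtain ⟨h, rfl⟩ := hj m' j' hm'
    exact ⟨m, j, hm, mono_of_mono j h, hj⟩
  prop_of_left c h := by
    rw [← hM.leftPerp_eq]
    exact fun m hm i hi hin => h i hi hin m hm
  left c hc i hi hin m hm := hM.subsingleton_ext hc hm hi hin
  right c hc i hi hin m hm := hM.subsingleton_ext hm hc hi hin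
  left_one S hS h₂ h m hm := subsingleton_ext_X₃_one hS m (fun g => h m g hm) (h₂ m hm)
  left_succ i S _ hS h₁ h₂ m hm := subsingleton_ext_X₃_succ hS m i (h₁ m hm) (h₂ m hm)
  exists_lift S hS h₁ m g hm := exists_lift_of_subsingleton_ext hS (h₁ m hm) g
  right_succ i S _ hS h₂ h₁ m hm := subsingleton_ext_X₃ hS m i (h₂ m hm) (h₁ m hm)

/-- Leaving `L` and `R` abstract in `IsVanishing` allows dualising by swapping them, with all `Ext`
groups still computed in `A`. -/
theorem IsNClusterTilting.isVanishing_op (hM : IsNClusterTilting.{w} n M) :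
    IsVanishing n M.op (fun i => (rightVanishing.{w} M i).op)
      (fun i => (leftVanishing.{w} M i).op) where
  isGenerating a := by
    obtain ⟨m, j, hm, hj⟩ := hM.isCogenerating a.unop
    exact ⟨.op m, j.op, hm, inferInstance⟩
  exists_mono a := by
    obtain ⟨m, j, hm, hj⟩ := hM.isPrecovering a.unop
    obtain ⟨m', j', hm', hj'⟩ := hM.isGenerating a.unop
    obtain ⟨h, rfl⟩ := hj m' j' hm'
    have := epi_of_epi h j
    refine ⟨.op m, j.op, hm, inferInstance, fun m'' g hm'' => ?_⟩
    obtain ⟨k, hk⟩ := hj m''.unop g.unop hm''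
    exact ⟨k.op, Quiver.Hom.unop_inj hk⟩
  prop_of_left c h := by
    change M c.unop
    rw [← hM.rightPerp_eq]
    exact fun m hm i hi hin => h i hi hin m hm
  left c hc i hi hin m hm := hM.subsingleton_ext hm hc hi hin
  right c hc i hi hin m hm := hM.subsingleton_ext hc hm hi hin
  left_one S hS h₂ h m hm := by
    refine subsingleton_ext_X₁_one hS.unop m (fun g => ?_) (h₂ m hm)
    obtain ⟨k, hk⟩ := h (.op m) g.op hm
    exact ⟨k.unop, Quiver.Hom.op_inj hk⟩
  left_succ i S _ hS h₁ h₂ m hm := subsingleton_ext_X₁_succ hS.unop m i (h₁ m hm) (h₂ m hm)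
  exists_lift S hS h₁ m g hm := by
    obtain ⟨k, hk⟩ := exists_desc_of_subsingleton_ext hS.unop (h₁ m.unop hm) g.unop
    exact ⟨k.op, Quiver.Hom.unop_inj hk⟩
  right_succ i S _ hS h₂ h₁ m hm := subsingleton_ext_X₁ hS.unop m i (h₂ m hm) (h₁ m hm)

end ExtVanishing

/-! ### Cluster tilting subcategories are `n`-abelian -/

section NAbelian

variable {A : Type u} [Category.{v} A] [Abelian A] {M : ObjectProperty A}

theorem IsAdditiveSubcategory.isClosedUnderFiniteProducts (hM : IsAdditiveSubcategory M) :
    M.IsClosedUnderFiniteProducts := by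
  have := hM.isClosedUnderIsomorphisms
  have := hM.containsZero
  have : M.IsClosedUnderBinaryProducts := ⟨by
    rintro X ⟨p⟩
    exact M.prop_of_iso
      (IsLimit.conePointsIsoOfNatIso (BinaryBiproduct.isLimit _ _) p.isLimit
        (diagramIsoPair p.diag).symm)
      (hM.biprod _ _ (p.prop_diag_obj ⟨.left⟩) (p.prop_diag_obj ⟨.right⟩))⟩
  exact .mk'

variable {C : Type u'} [Category.{v'} C] [Preadditive C] (G : C ⥤ A)
  [G.Full] [G.Faithful]
  (hG : ∀ c, M (G.obj c)) (hG' : ∀ a, M a → ∃ c, Nonempty (G.obj c ≅ a))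

include hG hG'

theorem IsAdditiveSubcategory.hasFiniteBiproducts (hM : IsAdditiveSubcategory M) :
    HasFiniteBiproducts C := by
  have := hM.isClosedUnderFiniteProducts
  have : (M.lift G hG).EssSurj :=
    ⟨fun ⟨a, ha⟩ => (hG' a ha).imp fun c ⟨e⟩ => ⟨M.ι.preimageIso e⟩⟩
  have : (M.lift G hG).IsEquivalence := {}
  have : HasFiniteProducts C :=
    ⟨fun k => Adjunction.hasLimitsOfShape_of_equivalence (M.lift G hG)⟩
  exact HasFiniteBiproducts.of_hasFiniteProducts

omit [Preadditive C] in
theorem IsAdditiveSubcategory.isIdempotentComplete (hM : IsAdditiveSubcategory M) :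
    IsIdempotentComplete C := by
  have := hM.isStableUnderRetracts
  refine ⟨fun X p hp => ?_⟩
  obtain ⟨Y, i, e, hie, hei⟩ := IsIdempotentComplete.idempotents_split (G.obj X) (G.map p)
    (by rw [← G.map_comp, hp])
  obtain ⟨c, ⟨f⟩⟩ := hG' Y (M.prop_of_retract ⟨i, e, hie⟩ (hG X))
  refine ⟨c, G.preimage (f.hom ≫ i), G.preimage (e ≫ f.inv), G.map_injective ?_,
    G.map_injective ?_⟩
  · simp [reassoc_of% hie]
  · simp [hei]

theorem IsNClusterTilting.isNAbelian [G.Additive] [HasExt.{w} A] {n : ℕ} (hn : 1 ≤ n)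
    (hM : IsNClusterTilting.{w} n M) : IsNAbelian C n := by
  have key {a b : C} (f : a ⟶ b) := hM.isVanishing.exists_natSequence hn hG hG' f
  have key' {a b : C} (f : a ⟶ b) := hM.isVanishing_op.exists_natSequence (G := G.op) hn
    (fun c => hG c.unop) (fun a ha => (hG' a.unop ha).elim fun c ⟨e⟩ => ⟨.op c, ⟨e.op.symm⟩⟩) f.op
  exact {
    hasFiniteBiproducts := hM.isAdditiveSubcategory.hasFiniteBiproducts G hG hG'
    isIdempotentComplete := hM.isAdditiveSubcategory.isIdempotentComplete G hG hG'
    exists_nCokernel := fun f => by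
      obtain ⟨X, d, e, hd, -⟩ := key f
      exact ⟨_, hd.isNCokernelSeq, (nonempty_iso_truncSeq n d).map fun i => i ≪≫ eqToIso e⟩
    exists_nExact_of_mono := fun f hf => by
      obtain ⟨X, d, e, hd, hd'⟩ := key f
      exact ⟨_, ⟨(hd' hf).isNKernelSeq, hd.isNCokernelSeq⟩,
        (nonempty_iso_truncSeq n d).map fun i => i ≪≫ eqToIso e⟩
    exists_nKernel := fun f => by
      obtain ⟨X, d, e, hd, -⟩ := key' f
      exact ⟨_, hd.isNKernelSeq_op, (nonempty_iso_truncOpSeq n).map fun i =>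
        i ≪≫ eqToIso (congrArg (Arrow.opEquiv C) e)⟩
    exists_nExact_of_epi := fun f hf => by
      obtain ⟨X, d, e, hd, hd'⟩ := key' f
      exact ⟨_, ⟨hd.isNKernelSeq_op, (hd' inferInstance).isNCokernelSeq_op⟩,
        (nonempty_iso_truncOpSeq n).map fun i => i ≪≫ eqToIso (congrArg (Arrow.opEquiv C) e)⟩ }

end NAbelian

/-! ### Transport of `Ext^n`-exactness and of cotorsion classes -/

section ExtExact

open Abelian

theorem IsExactWithZeros.of_iso {k : ℕ} {T T' : ComposableArrows AddCommGrpCat.{w} k} (e : T ≅ T')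
    (h : IsExactWithZeros T) : IsExactWithZeros T' := by
  have inj (i : Fin (k + 1)) : Function.Injective (e.inv.app i).hom :=
    (AddCommGrpCat.mono_iff_injective _).1 inferInstance
  have nat {i j : Fin (k + 1)} (f : i ⟶ j) (y : T'.obj i) :
      (e.inv.app j).hom ((T'.map f).hom y) = (T.map f).hom ((e.inv.app i).hom y) :=
    ConcreteCategory.congr_hom (e.inv.naturality f) y
  have inv_hom (i : Fin (k + 1)) (z : T.obj i) : (e.inv.app i).hom ((e.hom.app i).hom z) = z :=
    ConcreteCategory.congr_hom (e.hom_inv_id_app i) z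
  intro i y
  have key := h i ((e.inv.app i).hom y)
  constructor
  · intro hy
    obtain h0 | ⟨j, hj, z, hz⟩ := key.1 fun j hj => by rw [← nat, hy j hj, map_zero]
    · exact .inl (inj i (by rw [h0, map_zero]))
    · exact .inr ⟨j, hj, (e.hom.app j).hom z, inj i (by rw [nat, inv_hom, hz])⟩
  · intro hy j hj
    refine inj j ?_
    rw [nat, map_zero]
    refine key.2 ?_ j hj
    obtain rfl | ⟨l, hl, z, rfl⟩ := hy
    · exact .inl (map_zero _)
    · exact .inr ⟨l, hl, (e.inv.app l).hom z, by rw [nat]⟩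

variable {A : Type u} [Category.{v} A] [Abelian A] [HasExt.{w} A] {n : ℕ}

theorem ExtExact.of_iso_left {x y : A} (e : x ≅ y) {S : ComposableArrows A (n - 1)}
    (h : ExtExact.{w} n x S) : ExtExact.{w} n y S :=
  IsExactWithZeros.of_iso
    (Functor.isoWhiskerLeft S ((extFunctor.{w} (C := A) n).mapIso e.symm.op)) h

theorem ExtExact.of_iso_right {x : A} {S S' : ComposableArrows A (n - 1)} (e : S ≅ S')
    (h : ExtExact.{w} n x S) : ExtExact.{w} n x S' :=
  IsExactWithZeros.of_iso (Functor.isoWhiskerRight e (extFunctorObj.{w} x n)) h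

variable {B : Type u'} [Category.{v'} B] [Abelian B] [HasExt.{w} B]
  (F : A ⥤ B) [F.Additive] [PreservesFiniteLimits F] [PreservesFiniteColimits F]

/-- Naturality holds because an exact functor respects composition of `Ext` classes and the classes
of morphisms. -/
theorem nonempty_iso_comp_extFunctorObj {k : ℕ} (x : A) (S : ComposableArrows A k)
    (h : ∀ i, Function.Bijective
      (fun e : Ext.{w} x (S.obj i) n => (e.mapExactFunctor F : Ext.{w} _ _ n))) :
    Nonempty (S ⋙ extFunctorObj.{w} x n ≅ (S ⋙ F) ⋙ extFunctorObj.{w} (F.obj x) n) :=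
  ⟨NatIso.ofComponents
    (fun i => (AddEquiv.ofBijective (F.mapExtAddHom x (S.obj i) n) (h i)).toAddCommGrpIso)
    (fun {i j} f => AddCommGrpCat.ext fun (y : Ext.{w} x (S.obj i) n) => by
      change (y.comp (Ext.mk₀ (S.map f)) (add_zero n)).mapExactFunctor F =
        (y.mapExactFunctor F).comp (Ext.mk₀ (F.map (S.map f))) (add_zero n)
      rw [Ext.mapExactFunctor_comp, Ext.mapExactFunctor_mk₀])⟩

theorem extExact_comp_iff (x : A) (S : ComposableArrows A (n - 1))
    (h : ∀ i, Function.Bijective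
      (fun e : Ext.{w} x (S.obj i) n => (e.mapExactFunctor F : Ext.{w} _ _ n))) :
    ExtExact.{w} n (F.obj x) (S ⋙ F) ↔ ExtExact.{w} n x S := by
  obtain ⟨e⟩ := nonempty_iso_comp_extFunctorObj F x S h
  exact ⟨IsExactWithZeros.of_iso e.symm, IsExactWithZeros.of_iso e⟩

theorem IsNCotorsionClass.map [F.Full] [F.Faithful] {M X : ObjectProperty A}
    (h : ∀ a b : A, M a → M b → Function.Bijective
      (fun e : Ext.{w} a b n => (e.mapExactFunctor F : Ext.{w} _ _ n)))
    (hX : IsNCotorsionClass.{w} n M X) : IsNCotorsionClass.{w} n (M.map F) (X.map F) := by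
  have hXM : X ≤ M := by
    intro x hx
    rw [show X = _ from hX] at hx
    exact hx.1
  ext m
  constructor
  · rintro ⟨x, hx, ⟨e⟩⟩
    refine ⟨⟨x, hXM _ hx, ⟨e⟩⟩, fun S hS => ?_⟩
    -- Objects are lifted one by one; fullness lifts the conjugated maps and faithfulness gives
    -- functoriality.
    obtain ⟨S', hS', ⟨eS⟩⟩ : ∃ S' : ComposableArrows A (n - 1), (∀ i, M (S'.obj i)) ∧
        Nonempty (S' ⋙ F ≅ S) := by
      choose S' hS' eS using hS.1
      exact ⟨{
        obj := S'
        map := fun {i j} f => F.preimage ((eS i).some.hom ≫ S.map f ≫ (eS j).some.inv)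
        map_id := fun i => F.map_injective (by simp)
        map_comp := fun f g => F.map_injective (by simp) }, hS',
        ⟨NatIso.ofComponents (fun i => (eS i).some) (by simp)⟩⟩
    have hx' : perpXExact.{w} n M X x := by
      rw [← show X = _ from hX]
      exact hx
    refine ((extExact_comp_iff F x S' fun i => h _ _ (hXM _ hx) (hS' i)).2
      (hx'.2 S' ⟨hS', fun y hy => ?_⟩)).of_iso_right eS |>.of_iso_left e
    exact (extExact_comp_iff F y S' fun i => h _ _ (hXM _ hy) (hS' i)).1
      ((hS.2 _ (X.prop_map_obj F hy)).of_iso_right eS.symm)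
  · rintro ⟨⟨y, hy, ⟨e⟩⟩, hm⟩
    refine ⟨y, ?_, ⟨e⟩⟩
    rw [show X = _ from hX]
    refine ⟨hy, fun S hS => ?_⟩
    refine (extExact_comp_iff F y S fun i => h _ _ hy (hS.1 i)).1
      ((hm (S ⋙ F) ⟨fun i => M.prop_map_obj F (hS.1 i), ?_⟩).of_iso_left e.symm)
    rintro _ ⟨x, hx, ⟨e'⟩⟩
    exact ((extExact_comp_iff F x S fun i => h _ _ (hXM _ hx) (hS.1 i)).2
      (hS.2 x hx)).of_iso_left e'

end ExtExact

/-! ### The essential image under a fully faithful functor -/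

section EssentialImage

variable {A : Type u} [Category.{v} A] [Abelian A] [HasExt.{w} A]
  {B : Type u'} [Category.{v'} B] [Abelian B] (F : A ⥤ B) [F.Additive] [F.Full] [F.Faithful]

theorem IsNClusterTilting.isNAbelian_map {M : ObjectProperty A} {n : ℕ} (hn : 1 ≤ n)
    (hM : IsNClusterTilting.{w} n M) : IsNAbelian (M.map F).FullSubcategory n := by
  have := hM.isAdditiveSubcategory.isClosedUnderIsomorphisms
  let E : M.FullSubcategory ⥤ (M.map F).FullSubcategory :=
    (M.map F).lift (M.ι ⋙ F) fun c => M.prop_map_obj F c.2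
  have : E.Additive := { map_add := (M.map F).hom_ext (F.map_add) }
  have : E.EssSurj := ⟨fun ⟨b, a, ha, ⟨e⟩⟩ => ⟨⟨a, ha⟩, ⟨(M.map F).ι.preimageIso e⟩⟩⟩
  have : E.IsEquivalence := {}
  have : E.asEquivalence.functor.Additive := inferInstanceAs E.Additive
  have : E.inv.Additive := inferInstanceAs E.asEquivalence.inverse.Additive
  -- The image category is viewed inside `A`, where `M` is cluster tilting, rather than inside `B`.
  exact hM.isNAbelian (E.inv ⋙ M.ι) (fun c => (E.inv.obj c).2)
    (fun a ha => ⟨E.obj ⟨a, ha⟩, ⟨M.ι.mapIso (E.asEquivalence.unitIso.symm.app ⟨a, ha⟩)⟩⟩) hn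

end EssentialImage

/-! ### Restriction along a ring epimorphism is fully faithful -/

section RingEpi

variable {R S : Type u} [Ring R] [Ring S]

/-- The right action of `S` on an abelian group which is transported from a right module. -/
def conjAction {N N' : Type u} [AddCommGroup N] [AddCommGroup N'] [Module Sᵐᵒᵖ N] (e : N ≃+ N') :
    S →+* (AddMonoid.End N')ᵐᵒᵖ where
  toFun s := .op ((e.toAddMonoidHom.comp (Module.toAddMonoidEnd Sᵐᵒᵖ N (.op s))).comp
    e.symm.toAddMonoidHom)
  map_one' := MulOpposite.unop_injective (AddMonoidHom.ext fun x => by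
    change e ((1 : Sᵐᵒᵖ) • e.symm x) = x
    simp)
  map_mul' s t := MulOpposite.unop_injective (AddMonoidHom.ext fun x => by
    change e ((.op t * .op s : Sᵐᵒᵖ) • e.symm x) =
      e ((.op t : Sᵐᵒᵖ) • e.symm (e ((.op s : Sᵐᵒᵖ) • e.symm x)))
    simp [mul_smul])
  map_zero' := MulOpposite.unop_injective (AddMonoidHom.ext fun x => by
    change e ((0 : Sᵐᵒᵖ) • e.symm x) = 0
    simp)
  map_add' s t := MulOpposite.unop_injective (AddMonoidHom.ext fun x => by
    change e ((.op s + .op t : Sᵐᵒᵖ) • e.symm x) =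
      e ((.op s : Sᵐᵒᵖ) • e.symm x) + e ((.op t : Sᵐᵒᵖ) • e.symm x)
    simp [add_smul])

/-- The automorphism `(x, y) ↦ (x, g x + y)`. -/
def shear {N N' : Type u} [AddCommGroup N] [AddCommGroup N'] (g : N →+ N') : N × N' ≃+ N × N' where
  toFun p := (p.1, g p.1 + p.2)
  invFun p := (p.1, -g p.1 + p.2)
  left_inv p := by simp
  right_inv p := by simp
  map_add' p q := by
    ext
    · simp
    · simp only [Prod.fst_add, Prod.snd_add, map_add]
      abel

/-- The action of `S` on `N × N'` and its conjugate by the shear of `g` are ring homomorphisms that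
agree on `R`, as `g` is `R`-linear; hence they agree on `S`, which says that `g` is `S`-linear. -/
theorem map_smul_of_epi (f : R →+* S) (hf : Epi (RingCat.ofHom f)) {N N' : Type u}
    [AddCommGroup N] [AddCommGroup N'] [Module Sᵐᵒᵖ N] [Module Sᵐᵒᵖ N'] (g : N →+ N')
    (hg : ∀ (r : R) (x : N), g (MulOpposite.op (f r) • x) = MulOpposite.op (f r) • g x)
    (s : Sᵐᵒᵖ) (x : N) : g (s • x) = s • g x := by
  have h : RingCat.ofHom (conjAction (S := S) (.refl (N × N'))) =
      RingCat.ofHom (conjAction (shear g)) := by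
    rw [← cancel_epi (RingCat.ofHom f)]
    ext r
    refine MulOpposite.unop_injective (AddMonoidHom.ext fun p => Prod.ext rfl ?_)
    change MulOpposite.op (f r) • p.2 =
      g (MulOpposite.op (f r) • p.1) + MulOpposite.op (f r) • (-g p.1 + p.2)
    simp [hg]
  -- Second components of the two actions at `(x, 0)`.
  have h' : s • (0 : N') = g (s • x) + s • (-g x + 0) :=
    congrArg (fun k => (MulOpposite.unop (k.hom s.unop) (x, 0)).2) h
  simpa [← sub_eq_add_neg, sub_eq_zero] using h'.symm

variable {k : Type w} [CommRing k] [IsArtinianRing k] {Λ Λ' : Type u} [Ring Λ] [Algebra k Λ]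
  [Module.Finite k Λ] [Ring Λ'] [Algebra k Λ'] [Module.Finite k Λ']

instance (φ : Λ →ₐ[k] Λ') : (restrict φ).Faithful :=
  haveI : (restrict φ ⋙ toModuleCat k Λ).Faithful := inferInstanceAs
    (toModuleCat k Λ' ⋙ ModuleCat.restrictScalars (RingHom.op (φ : Λ →+* Λ'))).Faithful
  Functor.Faithful.of_comp (restrict φ) (toModuleCat k Λ)

theorem full_restrict (φ : Λ →ₐ[k] Λ') (hφ : Epi (RingCat.ofHom (φ : Λ →+* Λ'))) :
    (restrict φ).Full := by
  have h : (ModuleCat.restrictScalars.{u} (RingHom.op (φ : Λ →+* Λ'))).Full :=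
    ⟨fun {N N'} g => ⟨ModuleCat.ofHom
      { toFun := g.hom
        map_add' := g.hom.map_add
        map_smul' := map_smul_of_epi (φ : Λ →+* Λ') hφ g.hom.toAddMonoidHom
          fun r x => g.hom.map_smul (MulOpposite.op r) x }, rfl⟩⟩
  have : (restrict φ ⋙ toModuleCat k Λ).Full := inferInstanceAs
    (toModuleCat k Λ' ⋙ ModuleCat.restrictScalars (RingHom.op (φ : Λ →+* Λ'))).Full
  exact Functor.Full.of_comp_faithful (restrict φ) (toModuleCat k Λ)

end RingEpi

end HigherHomological

open HigherHomological
theorem mainTheorem7 {k : Type w} [CommRing k] [IsArtinianRing k]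
    {Λ Λ' : Type u} [Ring Λ] [Algebra k Λ] [Module.Finite k Λ]
    [Ring Λ'] [Algebra k Λ'] [Module.Finite k Λ']
    (n : ℕ) (hn : 1 ≤ n)
    (M : ObjectProperty (FGRightMod k Λ)) (M' : ObjectProperty (FGRightMod k Λ'))
    (φ : Λ →ₐ[k] Λ') (hφ : IsEpiOfNHomologicalPairs n M M' φ)
    (hExt : ∀ m' m'' : FGRightMod k Λ', M' m' → M' m'' →
      Function.Bijective (fun e : Abelian.Ext.{u + 1} m' m'' n => e.mapExactFunctor (restrict φ)))
    (X' : ObjectProperty (FGRightMod k Λ')) (hX' : IsNCotorsionClass.{u + 1} n M' X') :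
    IsNAbelian (M'.map (restrict φ)).FullSubcategory n ∧
      IsNCotorsionClass.{u + 1} n (M'.map (restrict φ)) (X'.map (restrict φ)) := by
  have := full_restrict φ hφ.epi
  have hM' : IsNClusterTilting.{u + 1} n M' := hφ.target
  exact ⟨hM'.isNAbelian_map (restrict φ) hn, hX'.map (restrict φ) hExt⟩
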